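/- Logarithms are to base 2. For probability distributions $P=p_1,\dots,p_n$ and $Q=q_1,\dots,q_n$ with all $q_i>0$ let $D(P\|Q)=\sum_{i} p_i\log(p_i/q_i)$, with $0\log 0=0$. The model of computation is the unit-cost word RAM with words of $w=\kappa(\lfloor\log n\rfloor+1)$ bits, $\kappa$ a positive integer constant: a fixed program uses a fixed finite set of one-word registers, performs addition, subtraction, multiplication, division, remainder, bitwise Boolean operations, shifts, comparisons and jumps, and may read, one word per step, a stored bit string packed into consecutive words. A query starts with its argument in a register and with no other information than the stored bits; the number that it returns is given exactly by three words $a,b,e$ representing $a/(b\,2^{e})$. There are a query program, a positive integer $\kappa$, a function $r:\mathbb N\to\mathbb N$ with $r(n)=o(n)$, and a constant $C$, such that the following holds. For every $n$, every probability distribution $P=p_1,\dots,p_n$ and every $\epsilon>0$ there are a probability distribution $Q=q_1,\dots,q_n$ with all $q_i>0$ and a data structure for it, that is, a string of at most $2n+r(n)$ bits, on which the program, given any $i$ with $1\le i\le n$, returns $q_i$ in at most $C\,(1+\log(1/q_i))$ steps. Here \[ D(P\|Q)<2+\epsilon \] and, for all $1\le i\le n$, \[ \log\frac1{q_i}\le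 C\Bigl(1+\log(1+\epsilon)+\log\min\Bigl(\frac1{p_i},\frac n\epsilon\Bigr)\Bigr), \] where $1/p_i=\infty$ if $p_i=0$. In particular, as long as $\epsilon$ is bounded by a constant, $\log(1/q_i)=O\bigl(1+\log^{+}\min(1/p_i,n/\epsilon)\bigr)$ uniformly in $n$, $P$, $\epsilon$ and $i$, where $\log^{+}x=\max(0,\log x)$. -/

import Mathlib

open Filter Asymptotics

/-- The binary operations of the word RAM. -/
inductive WordOp where
  | add | sub | mul | div | mod | and | or | xor | shl | shr

/-- The value of an operation on `w`-bit words (natural numbers below `2 ^ w`); arithmetic is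
modulo `2 ^ w`, bits shifted out of the word are lost. -/
def WordOp.eval (w : ℕ) : WordOp → ℕ → ℕ → ℕ
  | .add, x, y => (x + y) % 2 ^ w
  | .sub, x, y => (x + (2 ^ w - y)) % 2 ^ w
  | .mul, x, y => (x * y) % 2 ^ w
  | .div, x, y => (x / y) % 2 ^ w
  | .mod, x, y => (x % y) % 2 ^ w
  | .and, x, y => (x &&& y) % 2 ^ w
  | .or, x, y => (x ||| y) % 2 ^ w
  | .xor, x, y => (x ^^^ y) % 2 ^ w
  | .shl, x, y => (x * 2 ^ y) % 2 ^ w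
  | .shr, x, y => (x / 2 ^ y) % 2 ^ w

/-- Instructions of the word RAM; `d`, `a`, `b` are names of registers. -/
inductive RamInstr where
  /-- `reg d := c` -/
  | const (d c : ℕ)
  /-- `reg d := op (reg a) (reg b)` -/
  | bin (op : WordOp) (d a b : ℕ)
  /-- `reg d :=` the stored word whose address is `reg a` -/
  | load (d a : ℕ)
  /-- go to instruction number `target` -/
  | jump (target : ℕ)
  /-- go to instruction number `target` if `reg a < reg b` -/
  | jumpLt (a b target : ℕ)
  /-- stop -/
  | halt

/-- A program is a finite list of instructions, numbered from `0`. -/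
abbrev RamProgram := List RamInstr

/-- A configuration: the program counter and the contents of the registers. -/
structure RamConfig where
  pc : ℕ
  reg : ℕ → ℕ

/-- The word with address `a` when the bit string `data` is stored in consecutive `w`-bit words
(least significant bit first, padded with zeros). -/
def wordAt (w : ℕ) (data : List Bool) (a : ℕ) : ℕ :=
  ∑ j ∈ Finset.range w, if data.getD (a * w + j) false then 2 ^ j else 0

/-- One step of a program on `w`-bit words with read access to the stored bit string `data`.
Each instruction takes one step; a halted configuration does not change. -/
def RamProgram.step (prog : RamProgram) (w : ℕ) (data : List Bool) (c : RamConfig) : RamConfig :=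
  match prog[c.pc]? with
  | some (.const d k) => ⟨c.pc + 1, Function.update c.reg d (k % 2 ^ w)⟩
  | some (.bin op d a b) => ⟨c.pc + 1, Function.update c.reg d (op.eval w (c.reg a) (c.reg b))⟩
  | some (.load d a) => ⟨c.pc + 1, Function.update c.reg d (wordAt w data (c.reg a))⟩
  | some (.jump t) => ⟨t, c.reg⟩
  | some (.jumpLt a b t) => ⟨if c.reg a < c.reg b then t else c.pc + 1, c.reg⟩
  | some .halt => c
  | none => c

/-- The program has stopped: it is at a `halt` instruction or past its end. -/
def RamProgram.Halted (prog : RamProgram) (c : RamConfig) : Prop :=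
  prog[c.pc]? = some .halt ∨ prog[c.pc]? = none

/-- The initial configuration of a query: register `0` holds the argument, the others hold `0`. -/
def RamConfig.init (x : ℕ) : RamConfig :=
  ⟨0, fun r => if r = 0 then x else 0⟩

/-- The number that a configuration returns: the contents `a`, `b`, `e` of the registers
`0`, `1`, `2` represent `a / (b * 2 ^ e)`. -/
noncomputable def RamConfig.output (c : RamConfig) : ℝ :=
  (c.reg 0 : ℝ) / ((c.reg 1 : ℝ) * 2 ^ c.reg 2)

/-- Run on the stored bit string `data` with argument `x`, the program returns `y` after at most
`t` steps. -/
def RamProgram.ReturnsWithin (prog : RamProgram) (w : ℕ) (data : List Bool) (x : ℕ) (y : ℝ)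
    (t : ℕ) : Prop :=
  prog.Halted ((prog.step w data)^[t] (RamConfig.init x)) ∧
    ((prog.step w data)^[t] (RamConfig.init x)).output = y

/-- Relative entropy in bits, for a distribution `q` without zero probabilities. -/
noncomputable def relEntropy {n : ℕ} (p q : Fin n → ℝ) : ℝ :=
  ∑ i, p i * Real.logb 2 (p i / q i)

/-- `min (1 / p) x`, where `1 / p` is infinite for `p = 0`. -/
noncomputable def minRecip (p x : ℝ) : ℝ :=
  if p = 0 then x else min (1 / p) x

/-! Put `a i = ⌊n * P i / 3⌋ + 1`, `N = ∑ a i` and `Q i = a i / N`. Then `n * P i ≤ 3 * a i` and `3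
* N ≤ 4 * n`, so `P i ≤ 4 * Q i`. Every logarithm in the relative entropy is therefore at most 2,
and `Q` need not depend on `ε` (`relEntropy_le`).

The numbers `a i` are stored in unary, which takes `N` bits. A search tree sits over blocks of them:
the head of a block is kept in its node, and the rest of the block has sum at most `10 * w`
(`exists_blocks`). A node takes five words and all blocks but one are charged to weight `10 * w`, so
the tree takes at most `N / 2` bits beyond `O(w)`. The total is `3 * N / 2 + O(w) ≤ 2 * n + o(n)`
(`exists_data`).

Splitting at weighted medians halves the weight on each descent (`exists_balanced`), so a block
containing `x` is found after at most `log (N / x) = log (1 / q)` descents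
(`BlockTree.runs_search`). A head is then read at once. Any other number needs a scan of `O(w)`
steps, but such a number is itself at most `10 * w`, which forces `w = O(1 + log (N / x))`
(`word_le_log`). -/

/-- The program that answers queries. -/
def queryProgram : RamProgram :=
  [ .const 5 1,
    -- Register 2 is never written. Its initial 0 serves as the address of the word `N`, as the zero
    -- constant and as the exponent of the returned fraction.
    .load 1 2,
    .load 6 5,
    .const 3 2,
    -- 4: compare the argument with the block of the node at register 3
    .load 4 3,
    .jumpLt 0 4 15,
    .bin .add 3 3 5,
    .load 7 3,
    .bin .add 3 3 5,
    .jumpLt 0 7 18,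
    .bin .add 3 3 5,
    .bin .add 3 3 5,
    .load 4 3,
    .bin .add 3 3 4,
    .jump 4,
    -- 15: go to the left child
    .const 4 5,
    .bin .add 3 3 4,
    .jump 4,
    -- 18: the block is found
    .load 7 3,
    .jumpLt 4 0 22,
    .bin .add 0 7 2,
    .halt,
    -- 22: scan the unary codes
    .bin .add 3 3 5,
    .load 3 3,
    .bin .sub 0 0 4,
    .const 7 0,
    .bin .add 7 7 5,
    .bin .div 8 3 6,
    .load 8 8,
    .bin .mod 9 3 6,
    .bin .shr 8 8 9,
    .bin .and 8 8 5,
    .bin .add 3 3 5,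
    .jumpLt 2 8 26,
    .bin .sub 0 0 5,
    .jumpLt 2 0 25,
    .bin .add 0 7 2,
    .halt ]

/-! ### Words and bits of the stored string -/

section Bits

theorem testBit_sum_two_pow (f : ℕ → Bool) (w j : ℕ) :
    (∑ k ∈ Finset.range w, if f k then 2 ^ k else 0).testBit j = (decide (j < w) && f j) ∧
      (∑ k ∈ Finset.range w, if f k then 2 ^ k else 0) < 2 ^ w := by
  induction w with
  | zero => simp
  | succ w ih =>
    obtain ⟨h1, h2⟩ := ih
    rw [Finset.sum_range_succ]
    constructor
    · rcases lt_trichotomy j w with h | h | h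
      · by_cases hf : f w
        · rw [if_pos hf, add_comm, Nat.testBit_two_pow_add_gt h, h1]
          simp [h, h.trans (Nat.lt_succ_self w)]
        · simp only [hf]
          simp [h1, h, h.trans (Nat.lt_succ_self w)]
      · subst h
        by_cases hf : f j
        · rw [if_pos hf, add_comm, Nat.testBit_two_pow_add_eq, h1]
          simp [hf]
        · simp only [hf]
          simp [h1, hf]
      · have : (∑ k ∈ Finset.range w, if f k then 2 ^ k else 0) + (if f w then 2 ^ w else 0)
            < 2 ^ j := by
          calc _ < 2 ^ w + 2 ^ w := by
                split_ifs <;> omega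
            _ = 2 ^ (w + 1) := by ring
            _ ≤ 2 ^ j := Nat.pow_le_pow_right (by norm_num) h
        rw [Nat.testBit_lt_two_pow this]
        simp; omega
    · rw [pow_succ]
      split_ifs <;> omega

theorem testBit_wordAt (w : ℕ) (data : List Bool) (a j : ℕ) :
    (wordAt w data a).testBit j = (decide (j < w) && data.getD (a * w + j) false) :=
  (testBit_sum_two_pow (fun j => data.getD (a * w + j) false) w j).1

theorem wordAt_lt (w : ℕ) (data : List Bool) (a : ℕ) : wordAt w data a < 2 ^ w :=
  (testBit_sum_two_pow (fun j => data.getD (a * w + j) false) w 0).2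

/-- The bits of the `w`-bit words `ws`. -/
def bitsOfWords (w : ℕ) (ws : List ℕ) : List Bool :=
  ws.flatMap fun x => (List.range w).map x.testBit

theorem length_bitsOfWords (w : ℕ) (ws : List ℕ) : (bitsOfWords w ws).length = ws.length * w := by
  simp [bitsOfWords, List.length_flatMap]

theorem getD_bitsOfWords_append (w : ℕ) (ws : List ℕ) (bs : List Bool) (a j x : ℕ) (hj : j < w)
    (hx : ws[a]? = some x) : (bitsOfWords w ws ++ bs).getD (a * w + j) false = x.testBit j := by
  induction ws generalizing a with
  | nil => simp at hx
  | cons y ws ih =>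
    have e : bitsOfWords w (y :: ws) = (List.range w).map y.testBit ++ bitsOfWords w ws := rfl
    rw [e, List.append_assoc]
    cases a with
    | zero =>
      obtain rfl : y = x := by simpa using hx
      rw [List.getD_append _ _ _ _ (by simpa using hj)]
      simp [List.getD_eq_getElem?_getD, hj]
    | succ a =>
      rw [List.getD_append_right _ _ _ _ (by simp; nlinarith)]
      have : (a + 1) * w + j - ((List.range w).map y.testBit).length = a * w + j := by
        simp; rw [add_mul]; omega
      rw [this]
      exact ih a (by simpa using hx)

theorem wordAt_bitsOfWords_append (w : ℕ) (ws : List ℕ) (bs : List Bool) (a x : ℕ)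
    (hx : ws[a]? = some x) (hw : x < 2 ^ w) : wordAt w (bitsOfWords w ws ++ bs) a = x := by
  refine Nat.eq_of_testBit_eq fun j => ?_
  rw [testBit_wordAt]
  by_cases hj : j < w
  · rw [getD_bitsOfWords_append w ws bs a j x hj hx]; simp [hj]
  · have : x < 2 ^ j := hw.trans_le (Nat.pow_le_pow_right (by norm_num) (by omega))
    simp [hj, Nat.testBit_lt_two_pow this]

theorem wordAt_shift_mod_two (w : ℕ) (hw : 0 < w) (data : List Bool) (p : ℕ) :
    wordAt w data (p / w) / 2 ^ (p % w) % 2 = if data.getD p false then 1 else 0 := by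
  have h := testBit_wordAt w data (p / w) (p % w)
  rw [mul_comm, Nat.div_add_mod] at h
  rw [Nat.testBit_eq_decide_div_mod_eq] at h
  simp only [Nat.mod_lt p hw, decide_true, Bool.true_and] at h
  have := Nat.mod_two_eq_zero_or_one (wordAt w data (p / w) / 2 ^ (p % w))
  rw [← h]
  rcases this with h | h <;> simp [h]

/-- The function `f` takes the values `xs` from the argument `v` on. -/
def Holds {α : Type*} (f : ℕ → α) : ℕ → List α → Prop
  | _, [] => True
  | v, x :: xs => f v = x ∧ Holds f (v + 1) xs

theorem holds_append {α : Type*} (f : ℕ → α) (v : ℕ) (xs ys : List α) :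
    Holds f v (xs ++ ys) ↔ Holds f v xs ∧ Holds f (v + xs.length) ys := by
  induction xs generalizing v with
  | nil => simp [Holds]
  | cons x xs ih =>
    simp only [List.cons_append, Holds, ih, List.length_cons]
    rw [show v + 1 + xs.length = v + (xs.length + 1) by ring, and_assoc]

theorem holds_of_forall {α : Type*} (f : ℕ → α) (v : ℕ) (xs : List α)
    (h : ∀ j x, xs[j]? = some x → f (v + j) = x) : Holds f v xs := by
  induction xs generalizing v with
  | nil => trivial
  | cons x xs ih =>
    refine ⟨h 0 x (by simp), ih _ fun j y hy => ?_⟩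
    rw [show v + 1 + j = v + (j + 1) by ring]
    exact h (j + 1) y (by simpa using hy)

end Bits

/-! ### Unary codes -/

/-- The unary code of a positive number `a`, of length `a`. -/
def unaryCode (a : ℕ) : List Bool := List.replicate (a - 1) true ++ [false]

/-- The concatenation of unary codes. -/
def unaryStream (l : List ℕ) : List Bool := l.flatMap unaryCode

theorem length_unaryStream (l : List ℕ) (h : ∀ a ∈ l, 1 ≤ a) : (unaryStream l).length = l.sum := by
  induction l with
  | nil => rfl
  | cons a l ih =>
    have h1 := h a (by simp)
    have := ih fun b hb => h b (by simp [hb])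
    simp only [unaryStream, List.flatMap_cons, List.length_append, List.sum_cons] at *
    rw [this]; simp [unaryCode]; omega

/-! ### Symbolic execution of the query program -/

section Exec

variable {w : ℕ} {data : List Bool}

/-- The program goes from `c` to `c'` in `t` steps. -/
def Runs (w : ℕ) (data : List Bool) (t : ℕ) (c c' : RamConfig) : Prop :=
  (queryProgram.step w data)^[t] c = c'

theorem Runs.trans {s t : ℕ} {c c' c'' : RamConfig} (h : Runs w data s c c')
    (h' : Runs w data t c' c'') : Runs w data (s + t) c c'' := by
  unfold Runs at *
  rw [add_comm, Function.iterate_add_apply, h, h']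

/-- This leaves the final registers as an iterate, so a straight-line segment needs only its program
counter and the relevant registers evaluated by `simp`. -/
theorem runs_of_pc {t pc : ℕ} {c : RamConfig} (h : ((queryProgram.step w data)^[t] c).pc = pc) :
    Runs w data t c ⟨pc, ((queryProgram.step w data)^[t] c).reg⟩ := by
  unfold Runs
  rw [← h]

/-- The contents of the registers that stay fixed during a query: the common denominator `N`, the
constants `0` and `1`, and the word length. -/
structure FixedRegs (w N : ℕ) (ρ : ℕ → ℕ) : Prop where
  one : ρ 1 = N
  two : ρ 2 = 0
  five : ρ 5 = 1
  six : ρ 6 = w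

theorem runs_init {N i : ℕ} (hw2 : 1 < w) (hN : wordAt w data 0 = N) (hW : wordAt w data 1 = w) :
    ∃ ρ : ℕ → ℕ, Runs w data 4 (RamConfig.init i) ⟨4, ρ⟩ ∧ FixedRegs w N ρ ∧ ρ 0 = i ∧ ρ 3 = 2 := by
  have h1 : 1 < 2 ^ w := Nat.one_lt_two_pow (by omega)
  have h2 : 2 < 2 ^ w := lt_of_le_of_lt hw2 w.lt_two_pow_self
  have e1 := Nat.mod_eq_of_lt h1
  have e2 := Nat.mod_eq_of_lt h2
  refine ⟨_, runs_of_pc ?_, ⟨?_, ?_, ?_, ?_⟩, ?_, ?_⟩ <;>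
    simp [RamProgram.step, queryProgram, RamConfig.init, e1, e2, hN, hW]

theorem runs_left {N v : ℕ} {ρ : ℕ → ℕ} (h : FixedRegs w N ρ) (h3 : ρ 3 = v)
    (hi : ρ 0 < wordAt w data v) (hv : v + 5 < 2 ^ w) :
    ∃ ρ' : ℕ → ℕ, Runs w data 5 ⟨4, ρ⟩ ⟨4, ρ'⟩ ∧ FixedRegs w N ρ' ∧ ρ' 0 = ρ 0 ∧ ρ' 3 = v + 5 := by
  obtain ⟨h1, h2, h5, h6⟩ := h
  have e1 := Nat.mod_eq_of_lt hv
  have e2 := Nat.mod_eq_of_lt (show 5 < 2 ^ w by omega)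
  refine ⟨_, runs_of_pc ?_, ⟨?_, ?_, ?_, ?_⟩, ?_, ?_⟩ <;>
    simp [RamProgram.step, queryProgram, WordOp.eval, h1, h2, h3, h5, h6, hi, e1, e2]

theorem runs_right {N v o : ℕ} {ρ : ℕ → ℕ} (h : FixedRegs w N ρ) (h3 : ρ 3 = v)
    (hi : wordAt w data v ≤ ρ 0) (hi' : wordAt w data (v + 1) ≤ ρ 0)
    (ho : wordAt w data (v + 4) = o) (hv : v + 4 + o < 2 ^ w) :
    ∃ ρ' : ℕ → ℕ, Runs w data 11 ⟨4, ρ⟩ ⟨4, ρ'⟩ ∧ FixedRegs w N ρ' ∧ ρ' 0 = ρ 0 ∧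
      ρ' 3 = v + 4 + o := by
  obtain ⟨h1, h2, h5, h6⟩ := h
  have e1 := Nat.mod_eq_of_lt hv
  have e2 := Nat.mod_eq_of_lt (show v + 1 < 2 ^ w by omega)
  have e3 := Nat.mod_eq_of_lt (show v + 1 + 1 < 2 ^ w by omega)
  have e4 := Nat.mod_eq_of_lt (show v + 1 + 1 + 1 < 2 ^ w by omega)
  have e5 := Nat.mod_eq_of_lt (show v + 4 < 2 ^ w by omega)
  refine ⟨_, runs_of_pc ?_, ⟨?_, ?_, ?_, ?_⟩, ?_, ?_⟩ <;>
    simp [RamProgram.step, queryProgram, WordOp.eval, h1, h2, h3, h5, h6, hi.not_gt, hi'.not_gt,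
      e1, e2, e3, e4, e5, ho]

theorem runs_found {N v : ℕ} {ρ : ℕ → ℕ} (h : FixedRegs w N ρ) (h3 : ρ 3 = v)
    (hi : wordAt w data v ≤ ρ 0) (hi' : ρ 0 < wordAt w data (v + 1)) (hv : v + 2 < 2 ^ w) :
    ∃ ρ' : ℕ → ℕ, Runs w data 6 ⟨4, ρ⟩ ⟨18, ρ'⟩ ∧ FixedRegs w N ρ' ∧ ρ' 0 = ρ 0 ∧
      ρ' 3 = v + 2 ∧ ρ' 4 = wordAt w data v := by
  obtain ⟨h1, h2, h5, h6⟩ := h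
  have e2 := Nat.mod_eq_of_lt (show v + 1 < 2 ^ w by omega)
  have e3 := Nat.mod_eq_of_lt (show v + 1 + 1 < 2 ^ w by omega)
  refine ⟨_, runs_of_pc ?_, ⟨?_, ?_, ?_, ?_⟩, ?_, ?_, ?_⟩ <;>
    simp [RamProgram.step, queryProgram, WordOp.eval, h1, h2, h3, h5, h6, hi.not_gt, hi',
      e2, e3]

theorem runs_head {N a : ℕ} {ρ : ℕ → ℕ} (h : FixedRegs w N ρ) (hi : ρ 0 = ρ 4)
    (ha : wordAt w data (ρ 3) = a) (hv : a < 2 ^ w) :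
    ∃ ρ' : ℕ → ℕ, Runs w data 3 ⟨18, ρ⟩ ⟨21, ρ'⟩ ∧ FixedRegs w N ρ' ∧ ρ' 0 = a := by
  obtain ⟨h1, h2, h5, h6⟩ := h
  have e2 := Nat.mod_eq_of_lt hv
  refine ⟨_, runs_of_pc ?_, ⟨?_, ?_, ?_, ?_⟩, ?_⟩ <;>
    simp [RamProgram.step, queryProgram, WordOp.eval, h1, h2, h5, h6, hi, ha, e2]

theorem runs_enterScan {N s j p : ℕ} {ρ : ℕ → ℕ} (h : FixedRegs w N ρ) (h4 : ρ 4 = s)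
    (h0 : ρ 0 = s + j) (hj : 0 < j) (hp : wordAt w data (ρ 3 + 1) = p) (hs : s + j < 2 ^ w)
    (hv : ρ 3 + 1 < 2 ^ w) :
    ∃ ρ' : ℕ → ℕ, Runs w data 5 ⟨18, ρ⟩ ⟨25, ρ'⟩ ∧ FixedRegs w N ρ' ∧ ρ' 0 = j ∧ ρ' 3 = p := by
  obtain ⟨h1, h2, h5, h6⟩ := h
  have e2 := Nat.mod_eq_of_lt hv
  have e3 : (s + j + (2 ^ w - s)) % 2 ^ w = j := by
    rw [show s + j + (2 ^ w - s) = j + 2 ^ w by omega, Nat.add_mod_right,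
      Nat.mod_eq_of_lt (by omega)]
  refine ⟨_, runs_of_pc ?_, ⟨?_, ?_, ?_, ?_⟩, ?_, ?_⟩ <;>
    simp [RamProgram.step, queryProgram, WordOp.eval, h1, h2, h4, h0, h5, h6, hj, hp, e2, e3]

theorem runs_resetCount {N : ℕ} {ρ : ℕ → ℕ} (h : FixedRegs w N ρ) :
    ∃ ρ' : ℕ → ℕ, Runs w data 1 ⟨25, ρ⟩ ⟨26, ρ'⟩ ∧ FixedRegs w N ρ' ∧ ρ' 0 = ρ 0 ∧
      ρ' 3 = ρ 3 ∧ ρ' 7 = 0 := by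
  obtain ⟨h1, h2, h5, h6⟩ := h
  refine ⟨_, runs_of_pc ?_, ⟨?_, ?_, ?_, ?_⟩, ?_, ?_, ?_⟩ <;>
    simp [RamProgram.step, queryProgram, h1, h2, h5, h6]

theorem runs_readBit (hw : 0 < w) {N p c : ℕ} {ρ : ℕ → ℕ} (h : FixedRegs w N ρ)
    (h3 : ρ 3 = p) (h7 : ρ 7 = c) (hp : p + 1 < 2 ^ w) (hc : c + 1 < 2 ^ w) :
    ∃ ρ' : ℕ → ℕ, Runs w data 8 ⟨26, ρ⟩ ⟨if data.getD p false then 26 else 34, ρ'⟩ ∧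
      FixedRegs w N ρ' ∧ ρ' 0 = ρ 0 ∧ ρ' 3 = p + 1 ∧ ρ' 7 = c + 1 := by
  obtain ⟨h1, h2, h5, h6⟩ := h
  have e1 : p / w % 2 ^ w = p / w := Nat.mod_eq_of_lt ((Nat.div_le_self _ _).trans_lt (by omega))
  have e2 : p % w % 2 ^ w = p % w :=
    Nat.mod_eq_of_lt ((Nat.mod_lt _ hw).trans w.lt_two_pow_self)
  have e3 : wordAt w data (p / w) / 2 ^ (p % w) % 2 ^ w = wordAt w data (p / w) / 2 ^ (p % w) :=
    Nat.mod_eq_of_lt ((Nat.div_le_self _ _).trans_lt (wordAt_lt _ _ _))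
  have e4 := wordAt_shift_mod_two w hw data p
  have e5 := Nat.mod_eq_of_lt (Nat.one_lt_two_pow hw.ne')
  have e6 := Nat.mod_eq_of_lt hp
  have e7 := Nat.mod_eq_of_lt hc
  refine ⟨_, runs_of_pc ?_, ⟨?_, ?_, ?_, ?_⟩, ?_, ?_, ?_⟩ <;>
    simp [RamProgram.step, queryProgram, WordOp.eval, h1, h2, h3, h5, h6, h7, e1, e2, e3, e4, e6,
      e7]
  by_cases hb : data.getD p false = true
  · simp only [List.getD_eq_getElem?_getD] at hb
    simp [hb, e5]
  · simp only [List.getD_eq_getElem?_getD] at hb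
    simp [hb]

theorem runs_countDown {N j : ℕ} {ρ : ℕ → ℕ} (h : FixedRegs w N ρ) (h0 : ρ 0 = j + 1)
    (hj : j + 1 < 2 ^ w) :
    ∃ ρ' : ℕ → ℕ, Runs w data 2 ⟨34, ρ⟩ ⟨if 0 < j then 25 else 36, ρ'⟩ ∧ FixedRegs w N ρ' ∧
      ρ' 0 = j ∧ ρ' 3 = ρ 3 ∧ ρ' 7 = ρ 7 := by
  obtain ⟨h1, h2, h5, h6⟩ := h
  have e3 : (j + 1 + (2 ^ w - 1)) % 2 ^ w = j := by
    rw [show j + 1 + (2 ^ w - 1) = j + 2 ^ w by omega, Nat.add_mod_right,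
      Nat.mod_eq_of_lt (by omega)]
  refine ⟨_, runs_of_pc ?_, ⟨?_, ?_, ?_, ?_⟩, ?_, ?_, ?_⟩ <;>
    simp [RamProgram.step, queryProgram, WordOp.eval, h1, h2, h0, h5, h6, e3]

theorem runs_finish {N a : ℕ} {ρ : ℕ → ℕ} (h : FixedRegs w N ρ) (h7 : ρ 7 = a) (ha : a < 2 ^ w) :
    ∃ ρ' : ℕ → ℕ, Runs w data 1 ⟨36, ρ⟩ ⟨37, ρ'⟩ ∧ FixedRegs w N ρ' ∧ ρ' 0 = a := by
  obtain ⟨h1, h2, h5, h6⟩ := h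
  refine ⟨_, runs_of_pc ?_, ⟨?_, ?_, ?_, ?_⟩, ?_⟩ <;>
    simp [RamProgram.step, queryProgram, WordOp.eval, h1, h2, h5, h6, h7, Nat.mod_eq_of_lt ha]

/-- One unary code is read. -/
theorem runs_unaryCode (hw : 0 < w) {N b p c : ℕ} {ρ : ℕ → ℕ} (h : FixedRegs w N ρ)
    (h3 : ρ 3 = p) (h7 : ρ 7 = c) (hp : p + b + 1 < 2 ^ w) (hc : c + b + 1 < 2 ^ w)
    (hb : Holds (fun k => data.getD k false) p (List.replicate b true ++ [false])) :
    ∃ ρ' : ℕ → ℕ, Runs w data (8 * (b + 1)) ⟨26, ρ⟩ ⟨34, ρ'⟩ ∧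
      FixedRegs w N ρ' ∧ ρ' 0 = ρ 0 ∧ ρ' 3 = p + b + 1 ∧ ρ' 7 = c + b + 1 := by
  induction b generalizing p c ρ with
  | zero =>
    obtain ⟨ρ', h, hf⟩ := runs_readBit (data := data) hw h h3 h7 hp hc
    have : data.getD p false = false := hb.1
    rw [this] at h
    exact ⟨ρ', h, hf⟩
  | succ b ih =>
    obtain ⟨ρ', h, hf, f0, f3, f7⟩ :=
      runs_readBit (data := data) hw h h3 h7 (by omega) (by omega)
    have : data.getD p false = true := hb.1
    rw [this] at h
    obtain ⟨ρ'', h', hf', g0, g3, g7⟩ := ih hf f3 f7 (by omega) (by omega) hb.2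
    refine ⟨ρ'', ?_, hf', by rw [g0, f0], by omega, by omega⟩
    have := Runs.trans h h'
    rwa [show 8 + 8 * (b + 1) = 8 * (b + 1 + 1) by ring] at this

/-- The scan of a stream of unary codes up to the code number `j`. -/
theorem runs_scan (hw : 0 < w) {N p j x : ℕ} {ρ : ℕ → ℕ} {l : List ℕ} (h : FixedRegs w N ρ)
    (h0 : ρ 0 = j + 1) (h3 : ρ 3 = p) (hl : ∀ a ∈ l, 1 ≤ a) (hx : l[j]? = some x)
    (hp : p + l.sum < 2 ^ w) (hb : Holds (fun k => data.getD k false) p (unaryStream l)) :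
    ∃ (T : ℕ) (ρ' : ℕ → ℕ), Runs w data T ⟨25, ρ⟩ ⟨37, ρ'⟩ ∧ T ≤ 11 * l.sum + 1 ∧
      FixedRegs w N ρ' ∧ ρ' 0 = x := by
  induction l generalizing p j ρ with
  | nil => simp at hx
  | cons a l ih =>
    obtain ⟨b, rfl⟩ : ∃ b, a = b + 1 := ⟨a - 1, by have := hl a (by simp); omega⟩
    -- All codes are positive, so the index is below the sum, and the countdown register cannot
    -- overflow.
    have hj : j < (b + 1 + l.sum) := by
      have h1 : j < ((b + 1) :: l).length := (List.getElem?_eq_some_iff.1 hx).1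
      have h2 : ((b + 1) :: l).length ≤ ((b + 1) :: l).sum := by
        simpa using List.card_nsmul_le_sum ((b + 1) :: l) 1 hl
      rw [List.sum_cons] at h2
      omega
    rw [List.sum_cons] at hp
    have hs : unaryStream ((b + 1) :: l) = (List.replicate b true ++ [false]) ++ unaryStream l := rfl
    rw [hs, holds_append] at hb
    obtain ⟨ρ₁, r₁, f₁, a₁, b₁, c₁⟩ := runs_resetCount (data := data) h
    obtain ⟨ρ₂, r₂, f₂, a₂, b₂, c₂⟩ := runs_unaryCode (data := data) hw f₁ (b₁.trans h3) c₁
      (b := b) (by omega) (by omega) hb.1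
    obtain ⟨ρ₃, r₃, f₃, a₃, b₃, c₃⟩ := runs_countDown (data := data) f₂ (j := j)
      (by omega) (by omega)
    have r := (r₁.trans r₂).trans r₃
    cases j with
    | zero =>
      obtain rfl : b + 1 = x := by simpa using hx
      obtain ⟨ρ₄, r₄, f₄, a₄⟩ := runs_finish (data := data) f₃ (a := b + 1) (by omega) (by omega)
      refine ⟨_, ρ₄, r.trans r₄, ?_, f₄, a₄⟩
      -- A code of length `a ≥ 1` costs `1 + 8 * a + 2 ≤ 11 * a` steps; the extra 1 is the final
      -- move of the count into register 0.
      rw [List.sum_cons]; omega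
    | succ j =>
      obtain ⟨T, ρ₄, r₄, hT, f₄, a₄⟩ := ih (p := p + (b + 1)) (j := j) f₃ a₃ (by omega)
        (fun a ha => hl a (by simp [ha])) (by simpa using hx) (by omega) (by simpa using hb.2)
      refine ⟨_, ρ₄, r.trans r₄, ?_, f₄, a₄⟩
      rw [List.sum_cons]; omega

end Exec

/-! ### Block trees and the search in them -/

/-- Binary search trees whose nodes hold nonempty blocks `a :: rest` of numbers. -/
inductive BlockTree where
  | nil
  | node (l : BlockTree) (a : ℕ) (rest : List ℕ) (r : BlockTree)

namespace BlockTree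

/-- The numbers in the blocks, from left to right. -/
def vals : BlockTree → List ℕ
  | nil => []
  | node l a rest r => l.vals ++ ((a :: rest) ++ r.vals)

/-- The number of nodes. -/
def size : BlockTree → ℕ
  | nil => 0
  | node l _ _ r => l.size + 1 + r.size

/-- The words that represent a tree whose numbers have indices from `s` on and whose unary codes
start at the bit with address `p`. -/
def words (s p : ℕ) : BlockTree → List ℕ
  | nil => []
  | node l a rest r =>
    (s + l.vals.length) :: (s + l.vals.length + (rest.length + 1)) :: a :: (p + l.vals.sum + a) ::
      (1 + 5 * l.size) :: (words s p l ++
        words (s + l.vals.length + (rest.length + 1)) (p + l.vals.sum + (a + rest.sum)) r)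

/-- A subtree has at most half the weight of the tree, and the blocks without their first elements
have weight at most `L`. -/
def Balanced (L : ℕ) : BlockTree → Prop
  | nil => True
  | node l a rest r =>
    2 * l.vals.sum ≤ (node l a rest r).vals.sum ∧ 2 * r.vals.sum ≤ (node l a rest r).vals.sum ∧
      rest.sum ≤ L ∧ l.Balanced L ∧ r.Balanced L

theorem length_words (s p : ℕ) (t : BlockTree) : (t.words s p).length = 5 * t.size := by
  induction t generalizing s p with
  | nil => rfl
  | node l a rest r ihl ihr =>
    simp only [words, List.length_cons, List.length_append, ihl, ihr, size]
    ring

theorem le_of_mem_words {s p x : ℕ} {t : BlockTree} (hx : x ∈ t.words s p) :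
    x ≤ s + p + t.vals.length + t.vals.sum + 5 * t.size := by
  induction t generalizing s p with
  | nil => simp [words] at hx
  | node l a rest r ihl ihr =>
    simp only [words, List.mem_cons, List.mem_append] at hx
    simp only [vals, List.length_append, List.length_cons, List.sum_append, List.sum_cons, size]
    rcases hx with h | h | h | h | h | h | h
    · omega
    · omega
    · omega
    · omega
    · omega
    · have := ihl h
      omega
    · have := ihr h
      omega

theorem unaryStream_append (l l' : List ℕ) :
    unaryStream (l ++ l') = unaryStream l ++ unaryStream l' := List.flatMap_append

theorem unaryStream_cons (a : ℕ) (l : List ℕ) :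
    unaryStream (a :: l) = unaryCode a ++ unaryStream l := rfl

theorem length_unaryCode {a : ℕ} (h : 1 ≤ a) : (unaryCode a).length = a := by
  simp [unaryCode]; omega

/-- The search for the block of a number `x`. -/
theorem runs_search {w : ℕ} {data : List Bool} {N L s p v j x : ℕ} {ρ : ℕ → ℕ} {t : BlockTree}
    (ht : t.Balanced L) (hpos : ∀ a ∈ t.vals, 1 ≤ a) (hm : Holds (wordAt w data) v (t.words s p))
    (hb : Holds (fun k => data.getD k false) p (unaryStream t.vals))
    (hv : v + 5 * t.size < 2 ^ w) (hx : t.vals[j]? = some x) (h : FixedRegs w N ρ)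
    (h0 : ρ 0 = s + j) (h3 : ρ 3 = v) :
    ∃ (k T : ℕ) (ρ' : ℕ → ℕ) (a : ℕ) (rest : List ℕ) (j' s' p' : ℕ),
      Runs w data T ⟨4, ρ⟩ ⟨18, ρ'⟩ ∧ T ≤ 11 * (k + 1) ∧ 2 ^ k * x ≤ t.vals.sum ∧
      (a :: rest)[j']? = some x ∧ FixedRegs w N ρ' ∧ ρ' 0 = s + j ∧ s + j = s' + j' ∧ ρ' 4 = s' ∧
      wordAt w data (ρ' 3) = a ∧ wordAt w data (ρ' 3 + 1) = p' ∧ ρ' 3 + 1 < 2 ^ w ∧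
      Holds (fun k => data.getD k false) p' (unaryStream rest) ∧ rest.sum ≤ L ∧
      a ∈ t.vals ∧ (∀ b ∈ rest, b ∈ t.vals) ∧ p' + rest.sum ≤ p + t.vals.sum := by
  induction t generalizing s p v j ρ with
  | nil => simp [vals] at hx
  | node l a rest r ihl ihr =>
    obtain ⟨hwl, hwr, hL, hbl, hbr⟩ := ht
    simp only [vals, List.mem_append, List.mem_cons] at hpos
    have ha : 1 ≤ a := hpos a (by simp)
    have hposl : ∀ b ∈ l.vals, 1 ≤ b := fun b hb => hpos b (by simp [hb])
    have hposr : ∀ b ∈ r.vals, 1 ≤ b := fun b hb => hpos b (by simp [hb])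
    have hpose : ∀ b ∈ rest, 1 ≤ b := fun b hb => hpos b (by simp [hb])
    simp only [words, Holds, holds_append, length_words] at hm
    obtain ⟨m0, m1, m2, m3, m4, ml, mr⟩ := hm
    simp only [vals, unaryStream_append, unaryStream_cons, holds_append,
      length_unaryStream _ hposl, length_unaryCode ha] at hb
    obtain ⟨bl, ⟨-, be⟩, br⟩ := hb
    simp only [size] at hv
    simp only [vals] at hx hwl hwr ⊢
    rcases lt_or_ge j l.vals.length with hj | hj
    · rw [List.getElem?_append_left hj] at hx
      obtain ⟨ρ₁, r₁, f₁, a₁, b₁⟩ := runs_left (data := data) h h3 (by omega) (by omega)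
      obtain ⟨k, T, ρ₂, c, e, j', s', p', g₁, g₂, g₃, g₄, g₅, g₆, g₇, g₈, g₉, g₁₀, g₁₁, g₁₂, g₁₃,
        g₁₄, g₁₅, g₁₆⟩ :=
        ihl hbl hposl ml bl (by omega) hx f₁ (by omega) b₁
      refine ⟨k + 1, _, ρ₂, c, e, j', s', p', r₁.trans g₁, by omega, ?_, g₄, g₅, g₆, g₇, g₈, g₉,
        g₁₀, g₁₁, g₁₂, g₁₃, by simp [g₁₄], fun b hb => by simp [g₁₅ b hb], ?_⟩
      -- Balance pays for the descent: the subtree has at most half the weight, so the exponent may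
      -- grow by one.
      · rw [pow_succ]; linarith
      · rw [List.sum_append]; omega
    rw [List.getElem?_append_right hj] at hx
    rcases lt_or_ge (j - l.vals.length) (rest.length + 1) with hj' | hj'
    · rw [List.getElem?_append_left (by simpa using hj')] at hx
      obtain ⟨ρ₁, r₁, f₁, a₁, b₁, c₁⟩ :=
        runs_found (data := data) h h3 (by omega) (by omega) (by omega)
      refine ⟨0, 6, ρ₁, a, rest, j - l.vals.length, s + l.vals.length, p + l.vals.sum + a, r₁,
        by norm_num, ?_, hx, f₁, by omega, by omega, by omega, by rw [b₁]; exact m2,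
        by rw [b₁]; exact m3, by omega, be, hL, by simp, fun b hb => by simp [hb], ?_⟩
      · have hmem : x ∈ a :: rest := List.mem_of_getElem? hx
        have h1 := List.single_le_sum (l := a :: rest) (by simp) x hmem
        simp only [List.sum_append]
        omega
      · simp only [List.sum_append, List.sum_cons]
        omega
    · rw [List.getElem?_append_right (by simpa using hj')] at hx
      -- The offset is relative to the fifth word of the node: one more word leads to the left
      -- subtree, whose `5 * l.size` words are skipped.
      obtain ⟨ρ₁, r₁, f₁, a₁, b₁⟩ := runs_right (data := data) (o := 1 + 5 * l.size) h h3
        (by omega) (by omega) m4 (by omega)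
      obtain ⟨k, T, ρ₂, c, e, j', s', p', g₁, g₂, g₃, g₄, g₅, g₆, g₇, g₈, g₉, g₁₀, g₁₁, g₁₂, g₁₃,
        g₁₄, g₁₅, g₁₆⟩ :=
        ihr (j := j - l.vals.length - (a :: rest).length) (ρ := ρ₁) hbr hposr mr
          (by convert br using 2; simp [length_unaryCode ha, length_unaryStream _ hpose])
          (by omega) hx f₁ (by simp; omega) (by rw [b₁]; ring)
      simp only [List.length_cons] at g₆ g₇
      refine ⟨k + 1, _, ρ₂, c, e, j', s', p', r₁.trans g₁, by omega, ?_, g₄, g₅, by omega,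
        by omega, g₈, g₉,
        g₁₀, g₁₁, g₁₂, g₁₃, by simp [g₁₄], fun b hb => by simp [g₁₅ b hb], ?_⟩
      · rw [pow_succ]; linarith
      · simp only [List.sum_append, List.sum_cons]
        omega

end BlockTree

/-- A query for a number `x` of a tree. -/
theorem runs_query {w : ℕ} {data : List Bool} {N L j x : ℕ} {t : BlockTree} {p : ℕ} (hw : 1 < w)
    (hN : wordAt w data 0 = N) (hW : wordAt w data 1 = w)
    (ht : t.Balanced L) (hpos : ∀ a ∈ t.vals, 1 ≤ a)
    (hm : Holds (wordAt w data) 2 (t.words 1 p))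
    (hb : Holds (fun k => data.getD k false) p (unaryStream t.vals))
    (hsz : 2 + 5 * t.size < 2 ^ w) (hp : p + t.vals.sum < 2 ^ w) (hlen : 1 + t.vals.length < 2 ^ w)
    (hx : t.vals[j]? = some x) :
    ∃ (k T : ℕ) (y : RamConfig), Runs w data T (RamConfig.init (j + 1)) y ∧
      queryProgram.Halted y ∧ y.output = (x : ℝ) / N ∧ 2 ^ k * x ≤ t.vals.sum ∧
      (T ≤ 11 * k + 18 ∨ (T ≤ 11 * k + 21 + 11 * L ∧ x ≤ L)) := by
  have hjl : j < t.vals.length := (List.getElem?_eq_some_iff.1 hx).1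
  obtain ⟨ρ₁, r₁, f₁, a₁, b₁⟩ := runs_init (data := data) (i := j + 1) hw hN hW
  obtain ⟨k, T, ρ₂, a, rest, j', s', p', g₁, g₂, g₃, g₄, g₅, g₆, g₇, g₈, g₉, g₁₀, g₁₁, g₁₂, g₁₃,
    g₁₄, g₁₅, g₁₆⟩ := BlockTree.runs_search ht hpos hm hb hsz hx f₁ (by omega) b₁
  have hout : ∀ (pc : ℕ) (ρ : ℕ → ℕ), FixedRegs w N ρ → ρ 0 = x →
      (⟨pc, ρ⟩ : RamConfig).output = (x : ℝ) / N := by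
    intro pc ρ h h0
    simp [RamConfig.output, h.one, h.two, h0]
  -- Index 0 is the head, stored in the node; any other index lies in the unary part, where both the
  -- scan and the number itself are bounded in terms of `L`.
  cases j' with
  | zero =>
    obtain rfl : a = x := by simpa using g₄
    have : a ≤ t.vals.sum := List.single_le_sum (by simp) a g₁₄
    obtain ⟨ρ₃, r₃, f₃, a₃⟩ := runs_head (data := data) g₅ (by omega) g₉ (by omega)
    exact ⟨k, _, _, (r₁.trans g₁).trans r₃, Or.inl rfl, hout _ _ f₃ a₃, g₃, Or.inl (by omega)⟩
  | succ j' =>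
    have hx' : rest[j']? = some x := by simpa using g₄
    have hxl : x ≤ rest.sum := List.single_le_sum (by simp) x (List.mem_of_getElem? hx')
    obtain ⟨ρ₃, r₃, f₃, a₃, b₃⟩ := runs_enterScan (data := data) (j := j' + 1) g₅ g₈ (by omega)
      (by omega) g₁₀ (by omega) g₁₁
    obtain ⟨T', ρ₄, r₄, hT, f₄, a₄⟩ := runs_scan (data := data) (by omega) f₃ a₃ b₃
      (fun b hb => hpos b (g₁₅ b hb)) hx' (by omega) g₁₂
    exact ⟨k, _, _, ((r₁.trans g₁).trans r₃).trans r₄, Or.inl rfl, hout _ _ f₄ a₄, g₃,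
      Or.inr ⟨by omega, by omega⟩⟩

/-! ### Division into blocks and balancing -/

/-- The list `l` of numbers divided into nonempty blocks. -/
def flattenBlocks (bs : List (ℕ × List ℕ)) : List ℕ := bs.flatMap fun b => b.1 :: b.2

/-- Greedy division of a list into blocks. -/
theorem exists_blocks (L : ℕ) (l : List ℕ) :
    ∃ bs : List (ℕ × List ℕ), flattenBlocks bs = l ∧ (∀ b ∈ bs, b.2.sum ≤ L) ∧
      ∀ b bs', bs = b :: bs' → bs'.length * L + (b.1 + b.2.sum) ≤ l.sum := by
  induction l with
  | nil => exact ⟨[], rfl, by simp, by simp⟩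
  | cons a l ih =>
    obtain ⟨bs, h1, h2, h3⟩ := ih
    cases bs with
    | nil =>
      obtain rfl : [] = l := h1
      refine ⟨[(a, [])], rfl, by simp, ?_⟩
      rintro b bs' h
      obtain ⟨rfl, rfl⟩ := List.cons.inj h
      simp
    | cons b bs =>
      have h4 := h3 b bs rfl
      -- A light first block becomes the tail behind the new head. A block heavier than `L` is
      -- closed, and its weight pays for one more block in the count.
      by_cases hb : b.1 + b.2.sum ≤ L
      · refine ⟨(a, b.1 :: b.2) :: bs, ?_, ?_, ?_⟩
        · rw [← h1]; rfl
        · intro c hc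
          rcases List.mem_cons.1 hc with rfl | hc
          · simpa using hb
          · exact h2 c (by simp [hc])
        · rintro c bs' h
          obtain ⟨rfl, rfl⟩ := List.cons.inj h
          simp only [List.sum_cons]
          omega
      · refine ⟨(a, []) :: b :: bs, ?_, ?_, ?_⟩
        · rw [← h1]; rfl
        · intro c hc
          rcases List.mem_cons.1 hc with rfl | hc
          · simp
          · exact h2 c hc
        · rintro c bs' h
          obtain ⟨rfl, rfl⟩ := List.cons.inj h
          simp only [List.sum_cons, List.sum_nil, List.length_cons, add_mul, one_mul]
          omega

/-- A weighted median of a list. -/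
theorem exists_median {α : Type*} (f : List α → ℕ) (hf : ∀ l l', f (l ++ l') = f l + f l')
    (l : List α) (hl : l ≠ []) (c : ℕ) (hc : c ≤ f l) :
    ∃ l₁ b l₂, l = l₁ ++ b :: l₂ ∧ c + f l₁ ≤ f (b :: l₂) ∧ f l₂ ≤ c + f (l₁ ++ [b]) := by
  have h0 : f [] = 0 := by simpa using hf [] []
  induction l generalizing c with
  | nil => exact absurd rfl hl
  | cons b l ih =>
    by_cases h : f l ≤ c + f [b]
    · exact ⟨[], b, l, rfl, by simpa [h0] using hc, h⟩
    · obtain ⟨l₁, b', l₂, rfl, h1, h2⟩ := ih (by rintro rfl; simp [h0] at h) (c + f [b]) (by omega)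
      refine ⟨b :: l₁, b', l₂, rfl, ?_, ?_⟩
      · have := hf [b] l₁
        simp only [List.singleton_append] at this
        omega
      · have := hf [b] (l₁ ++ [b'])
        simp only [List.singleton_append] at this
        simp only [List.cons_append]
        omega

/-- The root is the weighted median block: neither side outweighs the other side together with the
median, so each side has at most half of the total. Recursion does the rest. -/
theorem exists_balanced (L : ℕ) (bs : List (ℕ × List ℕ)) (h : ∀ b ∈ bs, b.2.sum ≤ L) :
    ∃ t : BlockTree, t.vals = flattenBlocks bs ∧ t.size = bs.length ∧ t.Balanced L := by
  induction hn : bs.length using Nat.strong_induction_on generalizing bs with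
  | _ n ih =>
    subst hn
    by_cases hbs : bs = []
    · subst hbs
      exact ⟨.nil, rfl, rfl, trivial⟩
    have hf : ∀ l l', (flattenBlocks (l ++ l')).sum =
        (flattenBlocks l).sum + (flattenBlocks l').sum := by
      intro l l'
      simp [flattenBlocks, List.flatMap_append]
    obtain ⟨l₁, b, l₂, rfl, h1, h2⟩ :=
      exists_median (fun l => (flattenBlocks l).sum) hf bs hbs 0 (Nat.zero_le _)
    obtain ⟨t₁, v₁, s₁, b₁⟩ := ih l₁.length (by simp) l₁ (fun c hc => h c (by simp [hc])) rfl
    obtain ⟨t₂, v₂, s₂, b₂⟩ := ih l₂.length (by simp; omega) l₂ (fun c hc => h c (by simp [hc])) rfl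
    have e : (BlockTree.node t₁ b.1 b.2 t₂).vals = flattenBlocks (l₁ ++ b :: l₂) := by
      simp [BlockTree.vals, v₁, v₂, flattenBlocks]
    refine ⟨.node t₁ b.1 b.2 t₂, e, ?_, ?_, ?_, h b (by simp), b₁, b₂⟩
    · simp only [BlockTree.size, s₁, s₂, List.length_append, List.length_cons]; omega
    · rw [e, v₁, hf]; omega
    · have e3 := hf [b] l₂
      have e4 := hf l₁ [b]
      simp only [List.singleton_append] at e3
      rw [e, v₂, hf]
      omega

/-! ### The stored string and its length -/

/-- The size of the data and of the numbers in it fit into words. -/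
theorem lt_two_pow_word (n : ℕ) :
    1 + 5 * n + 14 * (8 * (Nat.log 2 n + 1)) < 2 ^ (8 * (Nat.log 2 n + 1)) := by
  have h1 : n < 2 ^ (Nat.log 2 n + 1) := Nat.lt_pow_succ_log_self (by norm_num) n
  have h2 : Nat.log 2 n + 1 < 2 ^ (Nat.log 2 n + 1) := Nat.lt_two_pow_self
  have h3 : 2 ≤ 2 ^ (Nat.log 2 n + 1) := by
    rw [pow_succ]; have := Nat.one_le_two_pow (n := Nat.log 2 n); omega
  rw [mul_comm 8 (Nat.log 2 n + 1), pow_mul]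
  generalize 2 ^ (Nat.log 2 n + 1) = M at *
  have h4 : 128 ≤ M ^ 7 := by simpa using Nat.pow_le_pow_left h3 7
  calc _ ≤ 128 * M - 1 := by omega
    _ < 128 * M := by omega
    _ ≤ M ^ 7 * M := Nat.mul_le_mul_right _ h4
    _ = M ^ 8 := by ring

/-- Positive numbers with small sum have a short data structure from which each of them is
found quickly. -/
theorem exists_data (n : ℕ) (l : List ℕ) (hl : l.length = n) (hpos : ∀ a ∈ l, 1 ≤ a)
    (hsum : 3 * l.sum ≤ 4 * n) :
    ∃ data : List Bool, data.length ≤ 2 * n + 7 * (8 * (Nat.log 2 n + 1)) ∧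
      ∀ (j x : ℕ), l[j]? = some x → ∃ k T : ℕ,
        queryProgram.ReturnsWithin (8 * (Nat.log 2 n + 1)) data (j + 1) ((x : ℝ) / l.sum) T ∧
        2 ^ k * x ≤ l.sum ∧ (T ≤ 11 * k + 18 ∨
          (T ≤ 11 * k + 21 + 110 * (8 * (Nat.log 2 n + 1)) ∧
            x ≤ 10 * (8 * (Nat.log 2 n + 1)))) := by
  have hfit := lt_two_pow_word n
  have hw8 : 8 ≤ 8 * (Nat.log 2 n + 1) := by omega
  generalize 8 * (Nat.log 2 n + 1) = w at *
  obtain ⟨bs, e1, e2, e3⟩ := exists_blocks (10 * w) l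
  obtain ⟨t, v, s, b⟩ := exists_balanced (10 * w) bs e2
  rw [e1] at v
  have hm : (5 * t.size) * w ≤ 5 * w + n := by
    rw [s]
    cases bs with
    | nil => simp
    | cons c bs =>
      have := e3 c bs rfl
      rw [mul_left_comm] at this
      rw [List.length_cons, mul_assoc, add_mul]
      omega
  -- The bit address of the unary stream: it follows two header words, `N` and `w`, and the words of
  -- the tree.
  set p := (2 + 5 * t.size) * w with hp
  have hp' : p ≤ 7 * w + n := by rw [hp, add_mul]; omega
  have hsz : 2 + 5 * t.size ≤ p := by rw [hp]; nlinarith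
  set ws : List ℕ := l.sum :: w :: t.words 1 p with hws
  have hwl : ws.length = 2 + 5 * t.size := by
    simp only [hws, List.length_cons, BlockTree.length_words]; ring
  have hword : ∀ x ∈ ws, x < 2 ^ w := by
    intro x hx
    simp only [hws, List.mem_cons] at hx
    rcases hx with rfl | rfl | hx
    · omega
    · omega
    · have := BlockTree.le_of_mem_words hx
      rw [v] at this
      omega
  have hread : ∀ a x, ws[a]? = some x → wordAt w (bitsOfWords w ws ++ unaryStream l) a = x :=
    fun a x hx => wordAt_bitsOfWords_append w ws _ a x hx (hword x (List.mem_of_getElem? hx))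
  have hlb : (bitsOfWords w ws).length = p := by rw [length_bitsOfWords, hwl]
  refine ⟨bitsOfWords w ws ++ unaryStream l, ?_, ?_⟩
  · rw [List.length_append, hlb, length_unaryStream _ hpos]
    cases bs with
    | nil =>
      simp only [List.length_nil] at s
      rw [hp, s]; omega
    | cons c bs =>
      -- With `m` blocks, `10 * w * (m - 1) ≤ N`, so the tree beyond its first node takes at most `N
      -- / 2` bits. With the stream this is `3 * N / 2 ≤ 2 * n`; the header and the first node give
      -- `7 * w`.
      have := e3 c bs rfl
      simp only [List.length_cons] at s
      rw [mul_left_comm] at this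
      rw [hp, s, add_mul, mul_assoc, add_mul]
      omega
  · intro j x hx
    obtain ⟨k, T, y, r, hh, ho, hk, hT⟩ := runs_query (w := w)
      (data := bitsOfWords w ws ++ unaryStream l) (p := p) (t := t) (N := l.sum) (by omega)
      (hread 0 _ rfl) (hread 1 _ rfl) b (by rwa [v])
      (holds_of_forall _ _ _ fun i z hz => hread _ z (by
        rw [hws, add_comm 2 i]; simpa using hz))
      (by
        rw [v]
        refine holds_of_forall _ _ _ fun i z hz => ?_
        rw [List.getD_append_right _ _ _ _ (by omega), hlb, Nat.add_sub_cancel_left,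
          List.getD_eq_getElem?_getD, hz]
        rfl)
      (by omega) (by rw [v]; omega) (by rw [v]; omega) (by rw [v]; exact hx)
    rw [v] at hk
    unfold Runs at r
    refine ⟨k, T, ⟨by rw [r]; exact hh, by rw [r]; exact ho⟩, hk, ?_⟩
    rcases hT with hT | hT
    · exact Or.inl hT
    · exact Or.inr ⟨by omega, hT.2⟩

/-! ### Estimates for the word length and the logarithms -/

theorem isLittleO_word (c : ℕ) :
    (fun n : ℕ => ((c * (8 * (Nat.log 2 n + 1)) : ℕ) : ℝ)) =o[atTop] (fun n : ℕ => (n : ℝ)) := by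
  have h1 : (fun n : ℕ => Real.log (n : ℝ)) =o[atTop] (fun n : ℕ => (n : ℝ)) :=
    Real.isLittleO_log_id_atTop.comp_tendsto tendsto_natCast_atTop_atTop
  have h2 : (fun _ : ℕ => (1 : ℝ)) =o[atTop] (fun n : ℕ => (n : ℝ)) :=
    (isLittleO_const_id_atTop (1 : ℝ)).comp_tendsto tendsto_natCast_atTop_atTop
  have h3 : (fun n : ℕ => (Nat.log 2 n : ℝ)) =O[atTop] (fun n : ℕ => Real.log (n : ℝ)) := by
    refine IsBigO.of_bound (1 / Real.log 2) (Eventually.of_forall fun n => ?_)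
    have h := Real.natLog_le_logb n 2
    rw [Real.logb] at h
    rw [Real.norm_of_nonneg (by positivity), Real.norm_of_nonneg (Real.log_natCast_nonneg n)]
    calc _ ≤ Real.log n / Real.log (2 : ℕ) := h
      _ = _ := by push_cast; ring
  have h4 := ((h3.trans_isLittleO h1).add h2).const_mul_left ((c : ℝ) * 8)
  refine h4.congr_left fun n => ?_
  push_cast; ring

/-- The word length is at most logarithmic in `n / w`. -/
theorem word_le_log {n x N : ℕ} (hn : 0 < n) (hx : 0 < x) (hN : n ≤ N)
    (h : x ≤ 10 * (8 * (Nat.log 2 n + 1))) :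
    ((8 * (Nat.log 2 n + 1) : ℕ) : ℝ) ≤ 16 * Real.logb 2 ((N : ℝ) / x) + 144 := by
  have h1 : 2 ^ Nat.log 2 n ≤ n := Nat.pow_log_le_self 2 hn.ne'
  generalize Nat.log 2 n = m at *
  -- The bound on `x` is linear in `m + 1`. Bounding that factor by a power with exponent about `m /
  -- 2` leaves half of `m` to be controlled by `log (N / x)`.
  have h2 : m + 1 ≤ 2 ^ ((m + 1) / 2 + 1) := by
    have := Nat.lt_two_pow_self (n := (m + 1) / 2)
    rw [pow_succ]; omega
  have h3 : 2 ^ m * x ≤ N * 2 ^ ((m + 1) / 2 + 8) := by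
    calc 2 ^ m * x ≤ N * (128 * 2 ^ ((m + 1) / 2 + 1)) :=
          Nat.mul_le_mul (h1.trans hN) (by omega)
      _ = _ := by ring
  have hx' : (0 : ℝ) < x := by exact_mod_cast hx
  have hN' : (0 : ℝ) < N := by exact_mod_cast hn.trans_le hN
  have h4 : (2 : ℝ) ^ m ≤ (N : ℝ) / x * 2 ^ ((m + 1) / 2 + 8) := by
    rw [div_mul_eq_mul_div, le_div_iff₀ hx']
    exact_mod_cast h3
  have h5 := Real.logb_le_logb_of_le (b := 2) (by norm_num) (by positivity) h4
  rw [Real.logb_mul (by positivity) (by positivity), Real.logb_pow, Real.logb_pow,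
    Real.logb_self_eq_one (by norm_num)] at h5
  have h6 : (((m + 1) / 2 : ℕ) : ℝ) ≤ (m + 1) / 2 := by
    have := @Nat.cast_div_le ℝ _ _ _ (m + 1) 2
    push_cast at this
    exact this
  push_cast at h5 ⊢
  linarith

/-- The construction gives a bound with `n` in place of `n / ε`. Since `n ≤ (1 + ε) * (n / ε)`, the
exchange costs a factor `1 + ε`, the source of the term `log (1 + ε)`. -/
theorem min_le_mul_minRecip {n p ε : ℝ} (hn : 0 ≤ n) (hp : 0 ≤ p) (hε : 0 < ε) :
    minRecip p n ≤ (1 + ε) * minRecip p (n / ε) := by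
  have h1 : n ≤ (1 + ε) * (n / ε) := by
    rw [mul_div_assoc', le_div_iff₀ hε]; nlinarith
  unfold minRecip
  split_ifs with h
  · exact h1
  · rcases min_choice (1 / p) (n / ε) with h2 | h2 <;> rw [h2]
    · have : 0 ≤ 1 / p := by positivity
      exact (min_le_left _ _).trans (by nlinarith)
    · exact (min_le_right _ _).trans h1

theorem relEntropy_le {n : ℕ} {p q : Fin n → ℝ} (hp : p ∈ stdSimplex ℝ (Fin n))
    (hq : ∀ i, 0 < q i) (h : ∀ i, p i ≤ 4 * q i) : relEntropy p q ≤ 2 := by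
  calc relEntropy p q ≤ ∑ i, p i * 2 := by
        refine Finset.sum_le_sum fun i _ => ?_
        rcases (hp.1 i).eq_or_lt with h0 | h0
        · simp [← h0]
        · refine mul_le_mul_of_nonneg_left ?_ h0.le
          rw [Real.logb_le_iff_le_rpow (by norm_num) (div_pos h0 (hq i)), div_le_iff₀ (hq i)]
          norm_num
          exact h i
    _ = 2 := by rw [← Finset.sum_mul, hp.2, one_mul]

/-! ### The main theorem -/

theorem theorem6 :
    ∃ (prog : RamProgram) (κ : ℕ) (r : ℕ → ℕ) (C : ℝ),
      0 < κ ∧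
      (fun n : ℕ => (r n : ℝ)) =o[atTop] (fun n : ℕ => (n : ℝ)) ∧
      ∀ (n : ℕ) (P : Fin n → ℝ) (ε : ℝ), P ∈ stdSimplex ℝ (Fin n) → 0 < ε →
        ∃ (Q : Fin n → ℝ) (data : List Bool),
          Q ∈ stdSimplex ℝ (Fin n) ∧
          (∀ i, 0 < Q i) ∧
          data.length ≤ 2 * n + r n ∧
          (∀ i : Fin n, ∃ t : ℕ,
            prog.ReturnsWithin (κ * (Nat.log 2 n + 1)) data ((i : ℕ) + 1) (Q i) t ∧
            (t : ℝ) ≤ C * (1 + Real.logb 2 (1 / Q i))) ∧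
          relEntropy P Q < 2 + ε ∧
          (∀ i : Fin n, Real.logb 2 (1 / Q i) ≤
            C * (1 + Real.logb 2 (1 + ε) + Real.logb 2 (minRecip (P i) (n / ε)))) := by
  -- The constant 20000 covers the worst case, a scan: `11 * k + 21 + 110 * w` with `w ≤ 16 * log (N
  -- / x) + 144`.
  refine ⟨queryProgram, 8, fun n => 7 * (8 * (Nat.log 2 n + 1)), 20000, by norm_num,
    isLittleO_word 7, fun n P ε hP hε => ?_⟩
  have hn : 0 < n := by
    rcases Nat.eq_zero_or_pos n with rfl | h
    · have := hP.2
      simp at this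
    · exact h
  have hn' : (0 : ℝ) < n := by exact_mod_cast hn
  have hn1 : (1 : ℝ) ≤ n := by exact_mod_cast hn
  -- The divisor 3 gives `N ≤ n / 3 + n`, matching both the entropy bound `log 4` and the space `3 *
  -- N / 2 ≤ 2 * n`.
  set a : Fin n → ℕ := fun i => ⌊(n : ℝ) * P i / 3⌋₊ + 1 with ha
  set N : ℕ := ∑ i, a i with hNdef
  have hPn : ∀ i, 0 ≤ P i := hP.1
  have ha1 : ∀ i, 1 ≤ a i := fun i => Nat.le_add_left _ _
  have ha2 : ∀ i, (n : ℝ) * P i / 3 ≤ a i := fun i => by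
    simp only [ha, Nat.cast_add, Nat.cast_one]
    exact (Nat.lt_floor_add_one _).le
  have hnN : n ≤ N := by
    calc n = ∑ _i : Fin n, 1 := by simp
      _ ≤ N := Finset.sum_le_sum fun i _ => ha1 i
  have hN' : (0 : ℝ) < N := by exact_mod_cast hn.trans_le hnN
  have hN3' : (3 : ℝ) * N ≤ 4 * n := by
    have h1 : (N : ℝ) ≤ ∑ i, ((n : ℝ) * P i / 3 + 1) := by
      rw [hNdef, Nat.cast_sum]
      refine Finset.sum_le_sum fun i _ => ?_
      simp only [ha, Nat.cast_add, Nat.cast_one]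
      have := Nat.floor_le (show 0 ≤ (n : ℝ) * P i / 3 by have := hPn i; positivity)
      linarith
    rw [Finset.sum_add_distrib, ← Finset.sum_div, ← Finset.mul_sum, hP.2] at h1
    simp at h1
    linarith
  have hN3 : 3 * N ≤ 4 * n := by exact_mod_cast hN3'
  have hls : (List.ofFn a).sum = N := List.sum_ofFn
  have ha0 : ∀ i, (0 : ℝ) < a i := fun i => by exact_mod_cast ha1 i
  have hq4 : ∀ i, P i ≤ 4 * ((a i : ℝ) / N) := fun i => by
    rw [mul_div_assoc', le_div_iff₀ hN']
    have := ha2 i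
    have := mul_le_mul_of_nonneg_left hN3' (hPn i)
    linarith
  obtain ⟨data, hlen, hquery⟩ := exists_data n (List.ofFn a) (by simp)
    (by
      intro x hx
      obtain ⟨i, rfl⟩ := (List.mem_ofFn' a x).1 hx
      exact ha1 i) (by rw [hls]; exact hN3)
  rw [hls] at hquery
  refine ⟨fun i => (a i : ℝ) / N, data, ⟨fun i => (div_pos (ha0 i) hN').le, ?_⟩,
    fun i => div_pos (ha0 i) hN', hlen, fun i => ?_,
    (relEntropy_le hP (fun i => div_pos (ha0 i) hN') hq4).trans_lt (by linarith), fun i => ?_⟩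
  · rw [← Finset.sum_div, ← Nat.cast_sum, ← hNdef, div_self hN'.ne']
  · obtain ⟨k, T, hret, hk, hT⟩ := hquery i (a i) (by simp)
    refine ⟨T, hret, ?_⟩
    rw [one_div_div]
    have hkl : (k : ℝ) ≤ Real.logb 2 ((N : ℝ) / a i) := by
      rw [Real.le_logb_iff_rpow_le (by norm_num) (div_pos hN' (ha0 i)), Real.rpow_natCast,
        le_div_iff₀ (ha0 i)]
      exact_mod_cast hk
    have hk0 : (0 : ℝ) ≤ k := by positivity
    rcases hT with hT | ⟨hT, hx⟩
    · have hT' : (T : ℝ) ≤ 11 * k + 18 := by exact_mod_cast hT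
      linarith
    · have hT' : (T : ℝ) ≤ 11 * k + 21 + 110 * ((8 * (Nat.log 2 n + 1) : ℕ) : ℝ) := by
        exact_mod_cast hT
      have := word_le_log hn (ha1 i) hnN hx
      linarith
  · rw [one_div_div]
    have hmin1 : 1 ≤ minRecip (P i) n := by
      unfold minRecip
      split_ifs with h0
      · exact hn1
      · have : 0 < P i := lt_of_le_of_ne (hPn i) (Ne.symm h0)
        have h1 : P i ≤ 1 := hP.2 ▸ Finset.single_le_sum (fun i _ => hPn i) (Finset.mem_univ i)
        exact le_min ((one_le_div this).2 h1) hn1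
    have hbound : (N : ℝ) / a i ≤ 4 * minRecip (P i) n := by
      have h1 : (N : ℝ) / a i ≤ 4 * n := by
        rw [div_le_iff₀ (ha0 i)]
        have : (1 : ℝ) ≤ a i := by exact_mod_cast ha1 i
        nlinarith
      unfold minRecip
      split_ifs with h0
      · exact h1
      · have hpos : 0 < P i := lt_of_le_of_ne (hPn i) (Ne.symm h0)
        have h2 : (N : ℝ) / a i ≤ 4 * (1 / P i) := by
          rw [mul_one_div, div_le_div_iff₀ (ha0 i) hpos]
          have := hq4 i
          rw [mul_div_assoc', le_div_iff₀ hN'] at this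
          linarith
        rcases min_choice (1 / P i) (n : ℝ) with h | h <;> rw [h] <;> assumption
    have hmr := min_le_mul_minRecip hn'.le (hPn i) hε
    -- For large `ε` the logarithm of the minimum may be negative; its sum with `log (1 + ε)` is
    -- not, so multiplying by the large constant only weakens the bound.
    have hprod : 1 ≤ (1 + ε) * minRecip (P i) (n / ε) := hmin1.trans hmr
    have hpos : 0 < minRecip (P i) (n / ε) := by
      by_contra hneg
      nlinarith
    have hlog := Real.logb_nonneg (b := 2) (by norm_num) hprod
    have hle := Real.logb_le_logb_of_le (b := 2) (by norm_num) (div_pos hN' (ha0 i))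
      (hbound.trans (mul_le_mul_of_nonneg_left hmr (by norm_num)))
    have h4 : Real.logb 2 4 = 2 := by
      rw [show (4 : ℝ) = 2 ^ 2 by norm_num, Real.logb_pow, Real.logb_self_eq_one (by norm_num)]
      norm_num
    rw [Real.logb_mul (by norm_num) (by positivity), h4] at hle
    rw [Real.logb_mul (by positivity) hpos.ne'] at hle hlog
    linarith
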